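/- Let $\mathbb K$ be $\mathbb R$ or $\mathbb C$, let $E$ be a separable Banach space over $\mathbb K$, and let $\Delta\subset[0,1]$ be the Cantor middle third set. Spaces $C(K)$ consist of $\mathbb K$-valued continuous functions with the supremum norm. Then $E$ embeds linearly and isometrically into $C(\Delta)$. For every linear isometric embedding $J:E\to C(\Delta)$, put $$X(E)=\{f\in C[0,1] : f|_\Delta\in J(E)\}.$$ Then the following hold. 1. $X(E)$ is a C-rich closed subspace of $C[0,1]$: it is closed, and for every nonempty open $U\subseteq[0,1]$ and every $\varepsilon>0$ there is a continuous function $h:[0,1]\to[0,\infty)$ with $\|h\|=1$, with (closed) support contained in $U$, and at distance less than $\varepsilon$ from $X(E)$. 2. $X(E)^*$ contains an isometric copy of $E^*$ as an $L$-summand: there are closed subspaces $Z,W$ of $X(E)^*$ with $X(E)^*=Z\oplus W$ and $\|z+w\|=\|z\|+\|w\|$ for all $z\in Z$, $w\in W$, such that $Z$ is linearly isometric to $E^*$. 3. There is a localizable positive measure $\mu$ such that $X(E)^*$ is linearly isometric to the $\ell_1$-sum $E^*\oplus_1 L_1(\mu)$. (A measure is localizable if every measurable set of infinite measure contains a measurable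 subset of finite positive measure, and every family $\mathcal A$ of measurable sets has an essential supremum, i.e. a measurable set $H$ such that $A\setminus H$ is null for all $A\in\mathcal A$, and $H\setminus G$ is null for every measurable $G$ for which $A\setminus G$ is null for all $A\in\mathcal A$.) -/

import Mathlib

open MeasureTheory Topology

noncomputable section

/-- The Cantor middle third set `Δ`, as a topological space, is compact. -/
instance cantorSetCompactSpace : CompactSpace cantorSet :=
  isCompact_iff_compactSpace.mp isCompact_cantorSet

/-- The restriction operator `P : C[0,1] → C(Δ)`, `(P f)(t) = f(t)` for `t ∈ Δ`. -/
def cantorRestrict (𝕜 : Type*) [RCLike 𝕜] : C(unitInterval, 𝕜) →ₗ[𝕜] C(cantorSet, 𝕜) where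
  toFun f := f.comp ⟨Set.inclusion cantorSet_subset_unitInterval, continuous_inclusion _⟩
  map_add' _ _ := rfl
  map_smul' _ _ := rfl

/-- `X(E) = {f ∈ C[0,1] : f|_Δ ∈ E}`, where `E` is regarded as a subspace of `C(Δ)` by means of the
linear isometric embedding `J`. -/
def cantorExtensionSpace {𝕜 : Type*} [RCLike 𝕜] {E : Type*} [NormedAddCommGroup E]
    [NormedSpace 𝕜 E] (J : E →ₗᵢ[𝕜] C(cantorSet, 𝕜)) : Submodule 𝕜 C(unitInterval, 𝕜) :=
  (LinearMap.range J.toLinearMap).comap (cantorRestrict 𝕜)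

/-- A closed subspace `X` of `C(K)` is C-rich if for every nonempty open `U ⊆ K` and every `ε > 0`
there is a positive (that is, pointwise nonnegative real) continuous function `h` of norm `1`, with
(closed) support inside `U`, at distance less than `ε` from `X`. -/
structure IsCRich {𝕜 : Type*} [RCLike 𝕜] {K : Type*} [TopologicalSpace K] [CompactSpace K]
    (X : Submodule 𝕜 C(K, 𝕜)) : Prop where
  isClosed : IsClosed (X : Set C(K, 𝕜))
  exists_near : ∀ U : Set K, IsOpen U → U.Nonempty → ∀ ε : ℝ, 0 < ε →
    ∃ h : C(K, 𝕜), (∀ t, 0 ≤ RCLike.re (h t) ∧ RCLike.im (h t) = 0) ∧ ‖h‖ = 1 ∧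
      tsupport h ⊆ U ∧ Metric.infDist h (X : Set C(K, 𝕜)) < ε

/-- The Banach dual `V^*` with the operator norm. This is `StrongDual 𝕜 V`; the abbreviation only makes
the topology on `V` be read off from its norm. -/
abbrev BanachDual (𝕜 : Type*) [RCLike 𝕜] (V : Type*) [NormedAddCommGroup V] [NormedSpace 𝕜 V] :
    Type _ :=
  StrongDual 𝕜 V

/-- A closed subspace `Z` of `V` is an `L`-summand if `V = Z ⊕₁ W` for some closed subspace `W`. -/
def IsLSummand {𝕜 : Type*} [RCLike 𝕜] {V : Type*} [NormedAddCommGroup V] [NormedSpace 𝕜 V]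
    (Z : Submodule 𝕜 V) : Prop :=
  IsClosed (Z : Set V) ∧ ∃ W : Submodule 𝕜 V, IsClosed (W : Set V) ∧ IsCompl Z W ∧
    ∀ z ∈ Z, ∀ w ∈ W, ‖z + w‖ = ‖z‖ + ‖w‖

/-- A (positive) measure is localizable if it is semifinite and every family of measurable sets has
an essential supremum among the measurable sets. -/
structure IsLocalizable {Ω : Type*} [MeasurableSpace Ω] (μ : Measure Ω) : Prop where
  semifinite : ∀ A : Set Ω, MeasurableSet A → μ A = ⊤ →
    ∃ B ⊆ A, MeasurableSet B ∧ 0 < μ B ∧ μ B < ⊤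
  exists_essSup : ∀ 𝒜 : Set (Set Ω), (∀ A ∈ 𝒜, MeasurableSet A) →
    ∃ H : Set Ω, MeasurableSet H ∧ (∀ A ∈ 𝒜, μ (A \ H) = 0) ∧
      ∀ G : Set Ω, MeasurableSet G → (∀ A ∈ 𝒜, μ (A \ G) = 0) → μ (H \ G) = 0

end

/-! A functional on $X(E)$ extends by Hahn–Banach to $C[0,1]$ and is then integration against a
finite measure with an integrable density. Its part on $\Delta$ sees only $f|_\Delta\in J(E)$, so it
is an element of $E^*$; its part off $\Delta$ is an arbitrary measure null on $\Delta$
(`surjective_cantorDualMap`). The norms add because a function prescribed on $\Delta$ can be altered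
freely off $\Delta$: blending an extension $F$ of a norming element with any $f$ in the unit ball
stays in the unit ball of $X(E)$ (`norm_cantorDualMap`).

The measures null on $\Delta$ form an $L_1(\mu)$: by Zorn there is a maximal pairwise singular
family of finite measures null on $\Delta$, and $\mu$ is its direct sum. A finite measure is
non-singular to only countably many members, so densities glue (`exists_map_snd_withDensity_eq`),
and so do signs (`exists_measurable_sign`).

C-richness holds since $\Delta$ is closed with empty interior, so bumps off $\Delta$ lie in $X(E)$.
The $L$-summand is read off from the $\ell_1$-decomposition. -/

noncomputable section

/-! ### Embedding into $C(\Delta)$ -/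

/-- The Banach–Mazur theorem: every separable normed space embeds linearly and isometrically into
the continuous functions on the Cantor set. -/
theorem exists_linearIsometry_cantorSet (𝕜 : Type*) [RCLike 𝕜] (E : Type*) [NormedAddCommGroup E]
    [NormedSpace 𝕜 E] [TopologicalSpace.SeparableSpace E] :
    Nonempty (E →ₗᵢ[𝕜] C(cantorSet, 𝕜)) := by
  let B : Set (WeakDual 𝕜 E) := WeakDual.toStrongDual ⁻¹' Metric.closedBall (0 : StrongDual 𝕜 E) 1
  have hB : IsCompact B := WeakDual.isCompact_closedBall (𝕜 := 𝕜) 0 1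
  have : CompactSpace B := isCompact_iff_compactSpace.mp hB
  -- Separability enters here: the weak-star dual ball is metrizable, hence a continuous image of
  -- the Cantor set.
  have : TopologicalSpace.MetrizableSpace B := WeakDual.metrizable_of_isCompact 𝕜 E B hB
  let _ : MetricSpace B := TopologicalSpace.metrizableSpaceMetric B
  have : Nonempty B := ⟨⟨0, by simp [B]⟩⟩
  obtain ⟨s, hs, hsurj⟩ := exists_nat_bool_continuous_surjective_of_compact B
  let q : cantorSet → B := s ∘ cantorSetHomeomorphNatToBool
  have hq : Continuous q := hs.comp cantorSetHomeomorphNatToBool.continuous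
  have hqsurj : Function.Surjective q := hsurj.comp cantorSetHomeomorphNatToBool.surjective
  let T : E →ₗ[𝕜] C(cantorSet, 𝕜) :=
    { toFun := fun x => ⟨fun t => (q t : WeakDual 𝕜 E) x,
        (WeakDual.eval_continuous x).comp (continuous_subtype_val.comp hq)⟩
      map_add' := fun x y => by ext t; simp
      map_smul' := fun c x => by ext t; simp }
  refine ⟨⟨T, fun x => le_antisymm ?_ ?_⟩⟩
  · refine (ContinuousMap.norm_le _ (norm_nonneg _)).mpr fun t => ?_
    have h1 : ‖WeakDual.toStrongDual (q t : WeakDual 𝕜 E)‖ ≤ 1 := by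
      have := (q t).2
      rwa [Set.mem_preimage, mem_closedBall_zero_iff] at this
    simpa only [one_mul] using! (WeakDual.toStrongDual (q t : WeakDual 𝕜 E)).le_of_opNorm_le h1 x
  · obtain ⟨g, hg, hgx⟩ := exists_dual_vector'' 𝕜 x
    obtain ⟨t, ht⟩ := hqsurj ⟨StrongDual.toWeakDual g, by simpa [B] using hg⟩
    have : T x t = (‖x‖ : 𝕜) := by
      change (q t : WeakDual 𝕜 E) x = _
      rw [ht]
      exact hgx
    calc ‖x‖ = ‖T x t‖ := by rw [this]; simp
      _ ≤ ‖T x‖ := (T x).norm_coe_le_norm t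

/-! ### The Cantor set in $[0,1]$ and restriction to it -/

/-- The Cantor set, as a subset of the unit interval. -/
def cantorUnit : Set unitInterval := {t | (t : ℝ) ∈ cantorSet}

theorem isClosed_cantorUnit : IsClosed cantorUnit :=
  isClosed_cantorSet.preimage continuous_subtype_val

theorem isTotallyDisconnected_cantorSet : IsTotallyDisconnected cantorSet := by
  rw [← totallyDisconnectedSpace_subtype_iff]
  exact cantorSetHomeomorphNatToBool.symm.totallyDisconnectedSpace

/-- The Cantor set has empty interior in the unit interval. -/
theorem exists_mem_notMem_cantorUnit {U : Set unitInterval} (hU : IsOpen U) (hne : U.Nonempty) :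
    ∃ t ∈ U, t ∉ cantorUnit := by
  by_contra! h
  obtain ⟨t, ht⟩ := hne
  obtain ⟨r, hr, hball⟩ := Metric.isOpen_iff.mp hU t ht
  obtain ⟨a, b, hab, ha, hb, hsub⟩ : ∃ a b : ℝ, a < b ∧ 0 ≤ a ∧ b ≤ 1 ∧
      ∀ x ∈ Set.Icc a b, |x - t| < r := by
    have h0 := t.2.1
    have h1 := t.2.2
    -- The interval extends to the right of `t`, except at the endpoint `1`.
    rcases lt_or_ge (t : ℝ) 1 with h | h
    · refine ⟨t, min 1 (t + r / 2), lt_min h (by linarith), h0, min_le_left _ _, fun x hx => ?_⟩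
      have := hx.2.trans (min_le_right _ _)
      rw [abs_lt]
      constructor <;> linarith [hx.1]
    · refine ⟨max 0 (t - r / 2), t, max_lt (by linarith) (by linarith), le_max_left _ _, h1,
        fun x hx => ?_⟩
      have := (le_max_right _ _).trans hx.1
      rw [abs_lt]
      constructor <;> linarith [hx.2]
  have hsubset : Set.Icc a b ⊆ cantorSet := fun x hx =>
    h ⟨x, ha.trans hx.1, hx.2.trans hb⟩ (hball (by
      rw [Metric.mem_ball, Subtype.dist_eq, Real.dist_eq]; exact hsub x hx))
  exact hab.ne (isTotallyDisconnected_cantorSet _ hsubset isPreconnected_Icc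
    (Set.left_mem_Icc.mpr hab.le) (Set.right_mem_Icc.mpr hab.le))

theorem cantorRestrict_apply {𝕜 : Type*} [RCLike 𝕜] (f : C(unitInterval, 𝕜)) (t : cantorSet) :
    cantorRestrict 𝕜 f t = f ⟨t, cantorSet_subset_unitInterval t.2⟩ := rfl

theorem norm_cantorRestrict_le {𝕜 : Type*} [RCLike 𝕜] (f : C(unitInterval, 𝕜)) :
    ‖cantorRestrict 𝕜 f‖ ≤ ‖f‖ :=
  (ContinuousMap.norm_le _ (norm_nonneg _)).mpr fun _ => f.norm_coe_le_norm _

theorem continuous_cantorRestrict (𝕜 : Type*) [RCLike 𝕜] : Continuous (cantorRestrict 𝕜) :=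
  AddMonoidHomClass.continuous_of_bound _ 1 fun f => by
    simpa using norm_cantorRestrict_le f

/-- Tietze extension from the Cantor set to the unit interval, without increase of the norm. -/
theorem exists_cantorRestrict_eq {𝕜 : Type*} [RCLike 𝕜] (g : C(cantorSet, 𝕜)) :
    ∃ F : C(unitInterval, 𝕜), cantorRestrict 𝕜 F = g ∧ ‖F‖ ≤ ‖g‖ := by
  obtain ⟨G, hG, hGr⟩ := BoundedContinuousFunction.exists_norm_eq_domRestrict_eq
    isClosed_cantorSet 𝕜 (BoundedContinuousFunction.mkOfCompact g)
  refine ⟨⟨fun t => G t, G.continuous.comp continuous_subtype_val⟩, ?_, ?_⟩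
  · ext t
    exact DFunLike.congr_fun hGr t
  · refine (ContinuousMap.norm_le _ (norm_nonneg _)).mpr fun t => ?_
    exact (G.norm_coe_le_norm _).trans (by rw [hG]; simp)

/-! ### C-richness -/

section

variable {𝕜 : Type*} [RCLike 𝕜] {E : Type*} [NormedAddCommGroup E] [NormedSpace 𝕜 E]

/-- A bump supported off $\Delta$ restricts to $0\in J(E)$, so it lies in the space itself and the
distance is zero. Closedness comes from completeness of $J(E)$. -/
theorem isCRich_cantorExtensionSpace [CompleteSpace E] (J : E →ₗᵢ[𝕜] C(cantorSet, 𝕜)) :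
    IsCRich (cantorExtensionSpace J) where
  isClosed := by
    have h : IsClosed (Set.range J) := J.isometry.isClosedEmbedding.isClosed_range
    have h2 := h.preimage (continuous_cantorRestrict 𝕜)
    exact h2
  exists_near U hU hne ε hε := by
    obtain ⟨t, htU, htΔ⟩ := exists_mem_notMem_cantorUnit hU hne
    obtain ⟨r, hr, hball⟩ := Metric.isOpen_iff.mp (hU.inter isClosed_cantorUnit.isOpen_compl) t
      ⟨htU, htΔ⟩
    let b : unitInterval → ℝ := fun s => max 0 (1 - 2 / r * dist s t)
    have hbc : Continuous b := by fun_prop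
    let h : C(unitInterval, 𝕜) := ⟨fun s => (b s : 𝕜), RCLike.continuous_ofReal.comp hbc⟩
    have hb0 : ∀ s, 0 ≤ b s := fun s => le_max_left _ _
    have hb1 : ∀ s, b s ≤ 1 := fun s => max_le zero_le_one (by
      have : 0 ≤ 2 / r * dist s t := by positivity
      linarith)
    have hsupp : tsupport h ⊆ Metric.closedBall t (r / 2) := by
      refine closure_minimal (fun s hs => ?_) Metric.isClosed_closedBall
      by_contra hcon
      rw [Metric.mem_closedBall, not_le] at hcon
      refine hs ?_
      have : (1 : ℝ) ≤ 2 / r * dist s t := by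
        rw [div_mul_eq_mul_div, le_div_iff₀ hr]; linarith
      simp only [h, b, ContinuousMap.coe_mk]
      rw [max_eq_left (by linarith)]
      simp
    have hsub : tsupport h ⊆ U ∩ cantorUnitᶜ := hsupp.trans
      ((Metric.closedBall_subset_ball (by linarith)).trans hball)
    refine ⟨h, fun s => by simp [h, hb0 s], le_antisymm ?_ ?_, hsub.trans Set.inter_subset_left, ?_⟩
    · refine (ContinuousMap.norm_le _ zero_le_one).mpr fun s => ?_
      simpa [h, abs_of_nonneg (hb0 s)] using hb1 s
    · have : h t = 1 := by simp [h, b]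
      simpa [this] using h.norm_coe_le_norm t
    · have hmem : h ∈ cantorExtensionSpace J := by
        refine ⟨0, ?_⟩
        ext s
        rw [cantorRestrict_apply, map_zero]
        by_contra hcon
        exact (hsub (subset_tsupport _ (Ne.symm hcon))).2 s.2
      rwa [Metric.infDist_zero_of_mem hmem]

end

/-! ### Riesz representation through the total variation -/

section Riesz

open scoped NNReal CompactlySupported

variable {𝕜 : Type*} [RCLike 𝕜] {K : Type*} [TopologicalSpace K]

/-- The total variation of a functional on `C(K)`, as a function of nonnegative `f`. -/
def functionalVariation (φ : StrongDual 𝕜 C(K, 𝕜)) (f : C_c(K, ℝ≥0)) : ℝ :=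
  ⨆ g : {g : C(K, 𝕜) // ∀ t, ‖g t‖ ≤ f t}, ‖φ g‖

theorem functionalVariation_le (φ : StrongDual 𝕜 C(K, 𝕜)) {f : C_c(K, ℝ≥0)} {C : ℝ}
    (h : ∀ g : C(K, 𝕜), (∀ t, ‖g t‖ ≤ f t) → ‖φ g‖ ≤ C) : functionalVariation φ f ≤ C := by
  have : Nonempty {g : C(K, 𝕜) // ∀ t, ‖g t‖ ≤ f t} := ⟨⟨0, by simp⟩⟩
  exact ciSup_le fun g => h g g.2

variable [CompactSpace K]

theorem norm_apply_le_functionalVariation (φ : StrongDual 𝕜 C(K, 𝕜)) {f : C_c(K, ℝ≥0)}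
    {g : C(K, 𝕜)} (hg : ∀ t, ‖g t‖ ≤ f t) : ‖φ g‖ ≤ functionalVariation φ f := by
  refine le_ciSup (f := fun g : {g : C(K, 𝕜) // ∀ t, ‖g t‖ ≤ f t} => ‖φ g‖) ?_ ⟨g, hg⟩
  let F : C(K, ℝ) := ⟨fun t => f t, by fun_prop⟩
  refine ⟨‖φ‖ * ‖F‖, ?_⟩
  rintro _ ⟨⟨g, hg⟩, rfl⟩
  refine φ.le_opNorm_of_le ((ContinuousMap.norm_le _ (norm_nonneg _)).mpr fun t => ?_)
  refine (hg t).trans ?_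
  simpa [F] using F.norm_coe_le_norm t

theorem functionalVariation_nonneg (φ : StrongDual 𝕜 C(K, 𝕜)) (f : C_c(K, ℝ≥0)) :
    0 ≤ functionalVariation φ f := by
  have := norm_apply_le_functionalVariation φ (f := f) (g := 0) (by simp)
  simpa using this

/-- For `≤`, split `g` in the ratio $f_1:f_2:\delta$; the small $\delta$ keeps the denominator
positive and costs at most $\varepsilon$. For `≥`, rotate $g_1,g_2$ by unimodular scalars so that
the values of $\varphi$ are nonnegative and add without cancellation. -/
theorem functionalVariation_add (φ : StrongDual 𝕜 C(K, 𝕜)) (f₁ f₂ : C_c(K, ℝ≥0)) :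
    functionalVariation φ (f₁ + f₂) = functionalVariation φ f₁ + functionalVariation φ f₂ := by
  apply le_antisymm
  · refine functionalVariation_le φ fun g hg => le_of_forall_pos_le_add fun ε hε => ?_
    set δ : ℝ := ε / (‖φ‖ + 1) with hδdef
    have hφ : 0 < ‖φ‖ + 1 := by positivity
    have hδ : 0 < δ := by positivity
    have hpos : ∀ t, 0 < (f₁ t : ℝ) + f₂ t + δ := fun t => by positivity
    have hle : ∀ t, ‖g t‖ ≤ (f₁ t : ℝ) + f₂ t + δ := fun t => by
      have := hg t
      simp only [CompactlySupportedContinuousMap.coe_add, Pi.add_apply, NNReal.coe_add] at this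
      linarith
    have hne : ∀ t, (f₁ t : ℝ) + f₂ t + δ ≠ 0 := fun t => (hpos t).ne'
    let cut (a : K → ℝ) (ha : Continuous a) : C(K, 𝕜) :=
      ⟨fun t => ((a t / ((f₁ t : ℝ) + f₂ t + δ) : ℝ) : 𝕜) * g t, by
        refine (RCLike.continuous_ofReal.comp (ha.div ?_ hne)).mul g.continuous
        fun_prop⟩
    have hcut : ∀ (a : K → ℝ) (ha : Continuous a), (∀ t, 0 ≤ a t) →
        ∀ t, ‖cut a ha t‖ ≤ a t := fun a ha ha0 t => by
      simp only [cut, ContinuousMap.coe_mk, norm_mul, RCLike.norm_ofReal, abs_div,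
        abs_of_nonneg (ha0 t), abs_of_pos (hpos t)]
      rw [div_mul_eq_mul_div, div_le_iff₀ (hpos t)]
      exact mul_le_mul_of_nonneg_left (hle t) (ha0 t)
    have hc1 : Continuous fun t => (f₁ t : ℝ) := by fun_prop
    have hc2 : Continuous fun t => (f₂ t : ℝ) := by fun_prop
    have hsum : g = cut _ hc1 + cut _ hc2 + cut (fun _ => δ) continuous_const := by
      ext t
      simp only [cut, ContinuousMap.add_apply, ContinuousMap.coe_mk]
      rw [← add_mul, ← add_mul, ← RCLike.ofReal_add, ← RCLike.ofReal_add, ← add_div, ← add_div,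
        div_self (hne t)]
      simp
    have h3 : ‖φ (cut (fun _ => δ) continuous_const)‖ ≤ ε := by
      have hn : ‖cut (fun _ => δ) continuous_const‖ ≤ δ :=
        (ContinuousMap.norm_le _ hδ.le).mpr (hcut _ continuous_const fun _ => hδ.le)
      calc _ ≤ ‖φ‖ * δ := φ.le_opNorm_of_le hn
        _ ≤ (‖φ‖ + 1) * δ := by gcongr; linarith
        _ = ε := by rw [hδdef]; field_simp
    rw [hsum, map_add, map_add]
    refine norm_add₃_le.trans (add_le_add (add_le_add ?_ ?_) h3)
    · exact norm_apply_le_functionalVariation φ (hcut _ hc1 fun t => NNReal.coe_nonneg _)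
    · exact norm_apply_le_functionalVariation φ (hcut _ hc2 fun t => NNReal.coe_nonneg _)
  · rw [← le_sub_iff_add_le]
    refine functionalVariation_le φ fun g₁ hg₁ => ?_
    rw [le_sub_comm]
    refine functionalVariation_le φ fun g₂ hg₂ => ?_
    rw [le_sub_iff_add_le]
    obtain ⟨c₁, hc₁, h₁⟩ := RCLike.exists_norm_eq_mul_self (φ g₁)
    obtain ⟨c₂, hc₂, h₂⟩ := RCLike.exists_norm_eq_mul_self (φ g₂)
    have key := norm_apply_le_functionalVariation φ (f := f₁ + f₂) (g := c₁ • g₁ + c₂ • g₂)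
      (fun t => by
        simp only [ContinuousMap.add_apply, ContinuousMap.smul_apply]
        refine (norm_add_le _ _).trans ?_
        rw [norm_smul, norm_smul, hc₁, hc₂, one_mul, one_mul]
        simpa using add_le_add (hg₁ t) (hg₂ t))
    rw [map_add, map_smul, map_smul, smul_eq_mul, smul_eq_mul, ← h₁, ← h₂, ← RCLike.ofReal_add,
      RCLike.norm_ofReal, abs_of_nonneg (by positivity)] at key
    linarith

theorem functionalVariation_smul (φ : StrongDual 𝕜 C(K, 𝕜)) (c : ℝ≥0) (f : C_c(K, ℝ≥0)) :
    functionalVariation φ (c • f) = c * functionalVariation φ f := by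
  have key : ∀ (c : ℝ≥0) (f : C_c(K, ℝ≥0)), c ≠ 0 →
      functionalVariation φ (c • f) ≤ c * functionalVariation φ f := fun c f hc => by
    have hc' : (0 : ℝ) < c := by positivity
    refine functionalVariation_le φ fun g hg => ?_
    have h := norm_apply_le_functionalVariation φ (f := f) (g := ((c : ℝ)⁻¹ : 𝕜) • g) (fun t => by
      have := hg t
      simp only [CompactlySupportedContinuousMap.coe_smul, Pi.smul_apply, smul_eq_mul,
        NNReal.coe_mul] at this
      rw [ContinuousMap.smul_apply, norm_smul, norm_inv, RCLike.norm_ofReal, abs_of_pos hc',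
        inv_mul_le_iff₀ hc']
      exact this)
    rwa [map_smul, norm_smul, norm_inv, RCLike.norm_ofReal, abs_of_pos hc',
      inv_mul_le_iff₀ hc'] at h
  rcases eq_or_ne c 0 with rfl | hc
  -- Additivity forces the variation of `0` to vanish.
  · have := functionalVariation_add φ 0 0
    rw [zero_smul]
    simp only [add_zero] at this
    simp only [NNReal.coe_zero, zero_mul]
    linarith
  · refine le_antisymm (key c f hc) ?_
    have hc' : (0 : ℝ) < c := by positivity
    have h := key c⁻¹ (c • f) (inv_ne_zero hc)
    rw [smul_smul, inv_mul_cancel₀ hc, one_smul, NNReal.coe_inv] at h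
    rwa [← le_inv_mul_iff₀ hc']

variable [T2Space K] [MeasurableSpace K] [BorelSpace K]

/-- A bounded functional on `C(K)` is dominated by the `L¹` seminorm of a finite measure. -/
theorem exists_measure_norm_apply_le (φ : StrongDual 𝕜 C(K, 𝕜)) :
    ∃ ν : Measure K, IsFiniteMeasure ν ∧ ν.Regular ∧ ∀ f, ‖φ f‖ ≤ ∫ t, ‖f t‖ ∂ν := by
  -- The variation is a positive linear functional, so Riesz–Markov–Kakutani applies to it.
  let Λ : C_c(K, ℝ≥0) →ₗ[ℝ≥0] ℝ≥0 :=
    { toFun := fun f => ⟨functionalVariation φ f, functionalVariation_nonneg φ f⟩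
      map_add' := fun f₁ f₂ => NNReal.eq (functionalVariation_add φ f₁ f₂)
      map_smul' := fun c f => NNReal.eq (functionalVariation_smul φ c f) }
  refine ⟨NNRealRMK.rieszMeasure Λ, inferInstance, inferInstance, fun f => ?_⟩
  let F : C_c(K, ℝ≥0) := ⟨⟨fun t => ‖f t‖₊, by fun_prop⟩, HasCompactSupport.of_compactSpace _⟩
  calc ‖φ f‖ ≤ functionalVariation φ F :=
        norm_apply_le_functionalVariation φ fun t => le_of_eq rfl
    _ = ∫ t, (F t : ℝ) ∂(NNRealRMK.rieszMeasure Λ) :=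
        (NNRealRMK.integral_rieszMeasure Λ F).symm
    _ = ∫ t, ‖f t‖ ∂(NNRealRMK.rieszMeasure Λ) := rfl

/-- Riesz representation for bounded functionals on `C(K)`. -/
theorem exists_integral_representation (φ : StrongDual 𝕜 C(K, 𝕜)) :
    ∃ (ν : Measure K) (h : K → 𝕜), IsFiniteMeasure ν ∧ StronglyMeasurable h ∧ Integrable h ν ∧
      ∀ f, φ f = ∫ t, f t * h t ∂ν := by
  obtain ⟨ν, _, _, hφ⟩ := exists_measure_norm_apply_le φ
  -- As $\nu$ is finite, the $L^1$ bound gives an $L^2$ bound; $\varphi$ then extends to $L^2(\nu)$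
  -- by density, and the Hilbert space Riesz theorem supplies the density function.
  have hbound : ∀ f : C(K, 𝕜),
      ‖φ f‖ ≤ (ν Set.univ ^ (1 / (1 : ENNReal).toReal - 1 / (2 : ENNReal).toReal)).toReal *
        ‖ContinuousMap.toLp 2 ν 𝕜 f‖ := fun f => by
    have hm : AEStronglyMeasurable f ν := f.continuous.aestronglyMeasurable
    have hae := ContinuousMap.coeFn_toLp (p := 2) (𝕜 := 𝕜) ν f
    have hlt : eLpNorm f 2 ν ≠ ⊤ := by
      rw [← eLpNorm_congr_ae hae]
      exact Lp.eLpNorm_ne_top _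
    have hle := eLpNorm_le_eLpNorm_mul_rpow_measure_univ (μ := ν) (p := 1) (q := 2)
      (by norm_num) hm
    rw [Lp.norm_def, eLpNorm_congr_ae hae, mul_comm, ← ENNReal.toReal_mul]
    refine (hφ f).trans ?_
    rw [integral_norm_eq_lintegral_enorm hm, ← eLpNorm_one_eq_lintegral_enorm]
    refine ENNReal.toReal_mono (ENNReal.mul_ne_top hlt ?_) hle
    exact ENNReal.rpow_ne_top_of_nonneg (by norm_num) (measure_ne_top ν _)
  have hdense : DenseRange (ContinuousMap.toLp 2 ν 𝕜 : C(K, 𝕜) →L[𝕜] Lp 𝕜 2 ν) :=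
    ContinuousMap.toLp_denseRange 𝕜 ν 𝕜 (by simp)
  let e : C(K, 𝕜) →ₗ[𝕜] Lp 𝕜 2 ν := (ContinuousMap.toLp 2 ν 𝕜).toLinearMap
  let Ψ : StrongDual 𝕜 (Lp 𝕜 2 ν) := φ.toLinearMap.extendOfNorm e
  have hΨ : ∀ f, Ψ (e f) = φ f := LinearMap.extendOfNorm_eq hdense ⟨_, hbound⟩
  let u : Lp 𝕜 2 ν := (InnerProductSpace.toDual 𝕜 _).symm Ψ
  have hu : MemLp u 2 ν := Lp.memLp u
  have hui : Integrable (fun t => u t) ν := hu.integrable (by norm_num)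
  -- The inner product is conjugate-linear in its first slot, whence `star`.
  refine ⟨ν, fun t => star (u t), inferInstance, ?_, ?_, fun f => ?_⟩
  · exact continuous_star.comp_stronglyMeasurable (Lp.stronglyMeasurable u)
  · exact hui.congr' (continuous_star.comp_aestronglyMeasurable hui.aestronglyMeasurable)
      (ae_of_all _ fun t => (norm_star _).symm)
  · rw [← hΨ f, ← InnerProductSpace.toDual_symm_apply, L2.inner_def]
    refine integral_congr_ae ?_
    filter_upwards [ContinuousMap.coeFn_toLp (p := 2) (𝕜 := 𝕜) ν f] with t ht
    change inner 𝕜 (u t) (ContinuousMap.toLp 2 ν 𝕜 f t) = _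
    rw [ht, RCLike.inner_apply]
    rfl

end Riesz

/-! ### Direct sums of measures and maximal singular families -/

section SigmaMeasure

open scoped ENNReal
open Function (onFun)

variable {ι X : Type*} [MeasurableSpace X]

theorem measurableSet_sigma_iff {A : Set (Σ _ : ι, X)} :
    MeasurableSet A ↔ ∀ i, MeasurableSet (Sigma.mk (β := fun _ => X) i ⁻¹' A) := by
  change MeasurableSet[⨅ a : ι, MeasurableSpace.map (Sigma.mk (β := fun _ => X) a) _] A ↔ _
  rw [MeasurableSpace.measurableSet_iInf]
  rfl

theorem measurable_sigma_iff {Y : Type*} [MeasurableSpace Y] {f : (Σ _ : ι, X) → Y} :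
    Measurable f ↔ ∀ i, Measurable fun t => f ⟨i, t⟩ :=
  ⟨fun h i _ hs => measurableSet_sigma_iff.mp (h hs) i,
    fun h _ hs => measurableSet_sigma_iff.mpr fun i => h i hs⟩

theorem measurable_sigmaMk (i : ι) : Measurable (Sigma.mk (β := fun _ => X) i) :=
  measurable_sigma_iff.mp measurable_id i

theorem measurable_sigmaSnd : Measurable (Sigma.snd : (Σ _ : ι, X) → X) :=
  measurable_sigma_iff.mpr fun _ => measurable_id

/-- The direct sum of a family of measures, on the disjoint union of copies of the space. -/
def sigmaMeasure (m : ι → Measure X) : Measure (Σ _ : ι, X) :=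
  Measure.sum fun i => (m i).map (Sigma.mk (β := fun _ => X) i)

variable {m : ι → Measure X}

theorem sigmaMeasure_apply {A : Set (Σ _ : ι, X)} (hA : MeasurableSet A) :
    sigmaMeasure m A = ∑' i, m i (Sigma.mk (β := fun _ => X) i ⁻¹' A) := by
  rw [sigmaMeasure, Measure.sum_apply _ hA]
  exact tsum_congr fun i => Measure.map_apply (measurable_sigmaMk i) hA

theorem sigmaMeasure_eq_zero_iff {A : Set (Σ _ : ι, X)} (hA : MeasurableSet A) :
    sigmaMeasure m A = 0 ↔ ∀ i, m i (Sigma.mk (β := fun _ => X) i ⁻¹' A) = 0 := by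
  rw [sigmaMeasure_apply hA, ENNReal.tsum_eq_zero]

theorem ae_sigmaMeasure_iff {p : (Σ _ : ι, X) → Prop} (hp : MeasurableSet {ω | p ω}) :
    (∀ᵐ ω ∂sigmaMeasure m, p ω) ↔ ∀ i, ∀ᵐ t ∂m i, p ⟨i, t⟩ :=
  sigmaMeasure_eq_zero_iff hp.compl

theorem lintegral_sigmaMeasure {f : (Σ _ : ι, X) → ℝ≥0∞} (hf : Measurable f) :
    ∫⁻ ω, f ω ∂sigmaMeasure m = ∑' i, ∫⁻ t, f ⟨i, t⟩ ∂m i := by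
  rw [sigmaMeasure, lintegral_sum_measure]
  exact tsum_congr fun i => lintegral_map hf (measurable_sigmaMk i)

/-- Over a finite measure, every family of measurable sets has an essential supremum. -/
theorem exists_essential_union (μ : Measure X) [IsFiniteMeasure μ] (𝒜 : Set (Set X))
    (h𝒜 : ∀ A ∈ 𝒜, MeasurableSet A) :
    ∃ C ⊆ 𝒜, C.Countable ∧ ∀ A ∈ 𝒜, μ (A \ ⋃₀ C) = 0 := by
  -- The supremum of these values is attained by merging a maximizing sequence; a member sticking
  -- out by positive measure would exceed it.
  let S : Set ℝ≥0∞ := {r | ∃ C ⊆ 𝒜, C.Countable ∧ r = μ (⋃₀ C)}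
  have hS : S.Nonempty := ⟨_, ∅, Set.empty_subset _, Set.countable_empty, rfl⟩
  obtain ⟨u, -, hu, huS⟩ := exists_seq_tendsto_sSup hS (OrderTop.bddAbove S)
  choose C hC𝒜 hCc hCu using huS
  have hmeas : ∀ D ⊆ 𝒜, D.Countable → MeasurableSet (⋃₀ D) := fun D hD hDc =>
    MeasurableSet.sUnion hDc fun A hA => h𝒜 A (hD hA)
  have hU : ⋃ n, C n ⊆ 𝒜 := Set.iUnion_subset hC𝒜
  have hUc : (⋃ n, C n).Countable := Set.countable_iUnion hCc
  refine ⟨⋃ n, C n, hU, hUc, fun A hA => ?_⟩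
  have hle : sSup S ≤ μ (⋃₀ ⋃ n, C n) := le_of_tendsto' hu fun n => by
    rw [hCu]
    exact measure_mono (Set.sUnion_subset_sUnion (Set.subset_iUnion C n))
  have hge : μ (A ∪ ⋃₀ ⋃ n, C n) ≤ sSup S := le_sSup
    ⟨insert A (⋃ n, C n), Set.insert_subset hA hU, hUc.insert A, by rw [Set.sUnion_insert]⟩
  have hadd : μ (⋃₀ ⋃ n, C n) + μ (A \ ⋃₀ ⋃ n, C n) = μ (A ∪ ⋃₀ ⋃ n, C n) := by
    rw [Set.union_comm, measure_union' disjoint_sdiff_self_right (hmeas _ hU hUc) |>.symm.trans]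
    rw [Set.union_sdiff_self]
  have h := hge.trans hle
  rw [← hadd] at h
  exact le_antisymm (ENNReal.le_of_add_le_add_left (measure_ne_top μ _) (by simpa using h)) bot_le

/-- Both properties reduce to the finite fibres. Measurability on the disjoint union is fibrewise,
so essential suprema glue over an index set of any size. -/
theorem isLocalizable_sigmaMeasure [∀ i, IsFiniteMeasure (m i)] :
    IsLocalizable (sigmaMeasure m) where
  semifinite A hA htop := by
    have hne : ¬ ∀ i, m i (Sigma.mk (β := fun _ => X) i ⁻¹' A) = 0 := fun h => by
      rw [(sigmaMeasure_eq_zero_iff hA).mpr h] at htop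
      exact ENNReal.zero_ne_top htop
    push Not at hne
    obtain ⟨i, hi⟩ := hne
    have hpre : ∀ j, j ≠ i → Sigma.mk (β := fun _ => X) j ⁻¹' (A ∩ {ω | ω.1 = i}) = ∅ := fun j hj => by
      ext t; simp [hj]
    have hprei : Sigma.mk (β := fun _ => X) i ⁻¹' (A ∩ {ω | ω.1 = i}) = Sigma.mk (β := fun _ => X) i ⁻¹' A := by
      ext t; simp
    have hB : MeasurableSet (A ∩ {ω | ω.1 = i}) := measurableSet_sigma_iff.mpr fun j => by
      rcases eq_or_ne j i with rfl | hj
      · rw [hprei]; exact measurableSet_sigma_iff.mp hA j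
      · rw [hpre j hj]; exact MeasurableSet.empty
    refine ⟨_, Set.inter_subset_left, hB, ?_⟩
    rw [sigmaMeasure_apply hB, tsum_eq_single i fun j hj => by rw [hpre j hj, measure_empty], hprei]
    exact ⟨pos_iff_ne_zero.mpr hi, measure_lt_top _ _⟩
  exists_essSup 𝒜 h𝒜 := by
    choose C hC𝒜 hCc hC using fun i => exists_essential_union (m i)
      ((fun A => Sigma.mk (β := fun _ => X) i ⁻¹' A) '' 𝒜)
      (by rintro _ ⟨A, hA, rfl⟩; exact measurableSet_sigma_iff.mp (h𝒜 A hA) i)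
    have hH : MeasurableSet {ω : Σ _ : ι, X | ω.2 ∈ ⋃₀ C ω.1} :=
      measurableSet_sigma_iff.mpr fun i => MeasurableSet.sUnion (hCc i) fun B hB => by
        obtain ⟨A, hA, rfl⟩ := hC𝒜 i hB
        exact measurableSet_sigma_iff.mp (h𝒜 A hA) i
    refine ⟨_, hH, fun A hA => ?_, fun G hG hAG => ?_⟩
    · rw [sigmaMeasure_eq_zero_iff ((h𝒜 A hA).diff hH)]
      exact fun i => hC i _ ⟨A, hA, rfl⟩
    · rw [sigmaMeasure_eq_zero_iff (hH.diff hG)]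
      intro i
      have : Sigma.mk (β := fun _ => X) i ⁻¹' ({ω : Σ _ : ι, X | ω.2 ∈ ⋃₀ C ω.1} \ G) =
          ⋃ B ∈ C i, B \ (Sigma.mk (β := fun _ => X) i ⁻¹' G) := by
        ext t
        simp only [Set.mem_preimage, Set.mem_sdiff, Set.mem_ofPred_eq, Set.mem_sUnion,
          Set.mem_iUnion, exists_prop]
        tauto
      rw [this, measure_biUnion_null_iff (hCc i)]
      intro B hB
      obtain ⟨A, hA, rfl⟩ := hC𝒜 i hB
      exact (sigmaMeasure_eq_zero_iff ((h𝒜 A hA).diff hG)).mp (hAG A hA) i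

/-- Countably many pairwise singular measures are carried by disjoint measurable sets. -/
theorem exists_disjoint_carriers [Countable ι] (hm : Pairwise (onFun Measure.MutuallySingular m)) :
    ∃ B : ι → Set X, (∀ i, MeasurableSet (B i)) ∧ Pairwise (onFun Disjoint B) ∧
      ∀ i, m i (B i)ᶜ = 0 := by
  have h : ∀ i j, ∃ S : Set X, MeasurableSet S ∧ (i ≠ j → m i S = 0 ∧ m j Sᶜ = 0) := fun i j => by
    rcases eq_or_ne i j with rfl | hij
    · exact ⟨∅, MeasurableSet.empty, fun h => absurd rfl h⟩
    · obtain ⟨S, hS, h1, h2⟩ := hm hij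
      exact ⟨S, hS, fun _ => ⟨h1, h2⟩⟩
  choose S hS hSm using h
  -- `S i j` is null for `m i` and conull for `m j`; also removing `S j i` makes the carriers
  -- disjoint.
  refine ⟨fun j => ⋂ i, ⋂ (_ : i ≠ j), S i j ∩ (S j i)ᶜ, fun j => ?_, fun i j hij => ?_, fun j => ?_⟩
  · exact MeasurableSet.iInter fun i => MeasurableSet.iInter fun _ => (hS i j).inter (hS j i).compl
  · refine Set.disjoint_left.mpr fun t hi hj => ?_
    exact (Set.mem_iInter₂.mp hi j hij.symm).2 (Set.mem_iInter₂.mp hj i hij).1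
  · simp only [Set.compl_iInter, Set.compl_inter, compl_compl]
    refine measure_iUnion_null fun i => measure_iUnion_null fun hij => measure_union_null ?_ ?_
    · exact (hSm i j hij).2
    · exact (hSm j i hij.symm).1

/-- Only countably many members of a singular family fail to be singular to a finite measure. -/
theorem countable_withDensity_rnDeriv_ne_zero
    (hm : Pairwise (onFun Measure.MutuallySingular m)) (ν : Measure X) [IsFiniteMeasure ν] :
    {i | (m i).withDensity (ν.rnDeriv (m i)) Set.univ ≠ 0}.Countable := by
  -- Each absolutely continuous part is at most `ν`; by disjoint carriers, finite sums of their
  -- masses stay below the mass of `ν`.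
  refine Summable.countable_support_ennreal (ne_top_of_le_ne_top (measure_ne_top ν Set.univ) ?_)
  rw [ENNReal.tsum_eq_iSup_sum]
  refine iSup_le fun F => ?_
  obtain ⟨B, hB, hd, hBc⟩ := exists_disjoint_carriers (ι := F) (m := fun i => m i)
    fun i j hij => hm (Subtype.coe_injective.ne hij)
  rw [← Finset.sum_coe_sort]
  calc ∑ i : F, (m i).withDensity (ν.rnDeriv (m i)) Set.univ
      ≤ ∑ i : F, ν (B i) := Finset.sum_le_sum fun i _ => by
        have h0 : (m i).withDensity (ν.rnDeriv (m i)) (B i)ᶜ = 0 :=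
          withDensity_absolutelyContinuous _ _ (hBc i)
        calc _ ≤ (m i).withDensity (ν.rnDeriv (m i)) (B i)
              + (m i).withDensity (ν.rnDeriv (m i)) (B i)ᶜ := by
              rw [← Set.union_compl_self (B i)]; exact measure_union_le _ _
          _ ≤ ν (B i) := by
              rw [h0, add_zero]
              exact Measure.withDensity_rnDeriv_le ν (m i) (B i)
    _ ≤ ν Set.univ := sum_measure_le_measure_univ (s := Finset.univ) (μ := ν)
        (fun i _ => (hB i).nullMeasurableSet) (fun i _ j _ hij => (hd hij).aedisjoint)

/-- If the pairwise singular family `m` is maximal among the finite measures null on `D`, then each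
finite measure null on `D` is the image of a measure with a density with respect to the direct
sum. -/
theorem exists_map_snd_withDensity_eq [∀ i, IsFiniteMeasure (m i)]
    (hm : Pairwise (onFun Measure.MutuallySingular m)) {D : Set X}
    (hmax : ∀ ν : Measure X, IsFiniteMeasure ν → ν D = 0 → (∀ i, ν.MutuallySingular (m i)) → ν = 0)
    (ν : Measure X) [IsFiniteMeasure ν] (hν : ν D = 0) :
    ∃ k : (Σ _ : ι, X) → ℝ≥0∞, Measurable k ∧ (∀ᵐ ω ∂sigmaMeasure m, k ω < ⊤) ∧
      ((sigmaMeasure m).withDensity k).map Sigma.snd = ν := by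
  let p : ι → Measure X := fun i => (m i).withDensity (ν.rnDeriv (m i))
  have hdec : ∀ i, ν = ν.singularPart (m i) + p i := fun i =>
    Measure.haveLebesgueDecomposition_add ν (m i)
  have hk : Measurable fun ω : Σ _ : ι, X => ν.rnDeriv (m ω.1) ω.2 :=
    measurable_sigma_iff.mpr fun i => Measure.measurable_rnDeriv ν (m i)
  refine ⟨_, hk, ?_, ?_⟩
  · rw [ae_sigmaMeasure_iff (measurableSet_lt hk measurable_const)]
    exact fun i => Measure.rnDeriv_lt_top ν (m i)
  let C : Set ι := {i | p i Set.univ ≠ 0}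
  have hC : C.Countable := countable_withDensity_rnDeriv_ne_zero hm ν
  have : Countable C := hC.to_subtype
  obtain ⟨B, hB, hd, hBc⟩ := exists_disjoint_carriers (ι := C) (m := fun i => m i)
    fun i j hij => hm (Subtype.coe_injective.ne hij)
  choose N hN hN1 hN2 using fun i => Measure.mutuallySingular_singularPart ν (m i)
  -- `N i` is null for the singular part, so `ν` agrees with `p i` on `B' i`.
  let B' : C → Set X := fun i => B i ∩ N i
  have hB' : ∀ i, MeasurableSet (B' i) := fun i => (hB i).inter (hN i)
  have hd' : Pairwise (onFun Disjoint B') := fun i j hij =>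
    (hd hij).mono Set.inter_subset_left Set.inter_subset_left
  have hBc' : ∀ i : C, m i (B' i)ᶜ = 0 := fun i => by
    rw [Set.compl_inter]
    exact measure_union_null (hBc i) (hN2 i)
  have hpν : ∀ (i : C) (A : Set X), MeasurableSet A → ν (A ∩ B' i) = p i A := fun i A hA => by
    have h0 : ν.singularPart (m i) (A ∩ B' i) = 0 :=
      measure_mono_null (Set.inter_subset_right.trans Set.inter_subset_right) (hN1 i)
    rw [hdec i, Measure.add_apply, h0, zero_add]
    refine measure_inter_conull' (measure_mono_null ?_ (withDensity_absolutelyContinuous _ _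
      (hBc' i)))
    exact fun t ht => ht.2
  -- What remains is singular to every `m i`, so maximality kills it.
  have hrest : ν.restrict (⋃ i, B' i)ᶜ = 0 := by
    refine hmax _ inferInstance (le_antisymm (hν ▸ Measure.restrict_le_self D) bot_le) fun i => ?_
    by_cases hi : i ∈ C
    · refine ⟨B' ⟨i, hi⟩, hB' _, ?_, hBc' ⟨i, hi⟩⟩
      rw [Measure.restrict_apply (hB' _)]
      refine measure_mono_null (t := ∅) (fun t ht => ht.2 (Set.mem_iUnion_of_mem _ ht.1)) ?_
      exact measure_empty
    · have h0 : p i = 0 := Measure.measure_univ_eq_zero.mp (not_not.mp hi)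
      have h1 : ν.MutuallySingular (m i) := by
        rw [hdec i, h0, add_zero]
        exact Measure.mutuallySingular_singularPart ν (m i)
      exact h1.mono Measure.restrict_le_self le_rfl
  ext A hA
  rw [Measure.map_apply measurable_sigmaSnd hA,
    withDensity_apply _ (measurable_sigmaSnd hA), ← lintegral_indicator (measurable_sigmaSnd hA),
    lintegral_sigmaMeasure (hk.indicator (measurable_sigmaSnd hA))]
  have h1 : ∀ i, ∫⁻ t, (Sigma.snd ⁻¹' A).indicator
      (fun ω : Σ _ : ι, X => ν.rnDeriv (m ω.1) ω.2) ⟨i, t⟩ ∂m i = p i A := fun i => by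
    rw [withDensity_apply _ hA, ← lintegral_indicator hA]
    rfl
  have h2 : ν A = ν (A ∩ ⋃ i, B' i) := by
    have h0 : ν (A ∩ (⋃ i, B' i)ᶜ) = 0 := by
      rw [← Measure.restrict_apply hA, hrest]; rfl
    rw [← measure_inter_add_sdiff A (MeasurableSet.iUnion hB'), Set.sdiff_eq, h0, add_zero]
  rw [tsum_congr h1, h2, Set.inter_iUnion, measure_iUnion
    (fun i j hij => (hd' hij).mono Set.inter_subset_right Set.inter_subset_right)
    (fun i => hA.inter (hB' i)), tsum_congr fun i => hpν i A hA]
  refine (tsum_subtype_eq_of_support_subset (f := fun i => p i A) (s := C) fun i hi => ?_).symm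
  exact fun h0 => hi (measure_mono_null (Set.subset_univ A) h0)

/-- There is a maximal pairwise singular family of finite measures null on `D`. -/
theorem exists_maximal_singular_family (D : Set X) :
    ∃ S : Set (Measure X), (∀ μ ∈ S, IsFiniteMeasure μ ∧ μ D = 0) ∧
      S.Pairwise Measure.MutuallySingular ∧
      ∀ ν : Measure X, IsFiniteMeasure ν → ν D = 0 → (∀ μ ∈ S, ν.MutuallySingular μ) → ν = 0 := by
  obtain ⟨S, hS⟩ := zorn_subset {S : Set (Measure X) | (∀ μ ∈ S, IsFiniteMeasure μ ∧ μ D = 0) ∧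
      S.Pairwise Measure.MutuallySingular} fun c hc hchain => by
    refine ⟨⋃₀ c, ⟨fun μ ⟨s, hs, hμ⟩ => (hc hs).1 μ hμ, ?_⟩, fun s hs => Set.subset_sUnion_of_mem hs⟩
    exact (Set.pairwise_sUnion hchain.directedOn).mpr fun s hs => (hc hs).2
  refine ⟨S, hS.prop.1, hS.prop.2, fun ν hfin hν hsing => ?_⟩
  -- Maximality puts `ν` in `S`, making it singular to itself.
  have hins : insert ν S ⊆ S := hS.2 ⟨?_, ?_⟩ (Set.subset_insert ν S)
  · exact Measure.MutuallySingular.self_iff ν |>.mp (hsing ν (hins (Set.mem_insert ν S)))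
  · rintro μ (rfl | hμ)
    exacts [⟨hfin, hν⟩, hS.prop.1 μ hμ]
  · exact hS.prop.2.insert fun μ hμ _ => ⟨hsing μ hμ, (hsing μ hμ).symm⟩

end SigmaMeasure

/-! ### Integrable functions as functionals on $C(X)$ -/

section SignFunctions

open scoped ENNReal
open Function (onFun)

variable {𝕜 : Type*} [RCLike 𝕜] {ι X : Type*} [MeasurableSpace X] {m : ι → Measure X}

/-- An integrable function on the direct sum of pairwise singular measures has a common conjugate
sign function on the underlying space. -/
theorem exists_measurable_sign (hm : Pairwise (onFun Measure.MutuallySingular m))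
    {g : (Σ _ : ι, X) → 𝕜} (hg : Measurable g) (hgi : Integrable g (sigmaMeasure m)) :
    ∃ v : X → 𝕜, Measurable v ∧ (∀ t, ‖v t‖ ≤ 1) ∧
      ∀ᵐ ω ∂sigmaMeasure m, v ω.2 * g ω = (‖g ω‖ : 𝕜) := by
  let c : 𝕜 → 𝕜 := fun z => (‖z‖ : 𝕜)⁻¹ * star z
  have hcm : Measurable c :=
    (RCLike.continuous_ofReal.measurable.comp measurable_norm).inv.mul continuous_star.measurable
  have hc1 : ∀ z, ‖c z‖ ≤ 1 := fun z => by
    simp only [c, norm_mul, norm_inv, RCLike.norm_ofReal, abs_norm, norm_star]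
    exact inv_mul_le_one
  have hcz : ∀ z, c z * z = (‖z‖ : 𝕜) := fun z => by
    rcases eq_or_ne z 0 with rfl | hz
    · simp
    · have hz' : (‖z‖ : 𝕜) ≠ 0 := by simpa using hz
      have : star z * z = (‖z‖ : 𝕜) ^ 2 := RCLike.conj_mul z
      simp only [c]
      rw [mul_assoc, this, sq, inv_mul_cancel_left₀ hz']
  have hgm : ∀ i, Measurable fun t => g ⟨i, t⟩ := measurable_sigma_iff.mp hg
  -- Integrability leaves countably many nonzero fibres, so their signs live on disjoint carriers in
  -- `X` and merge into one function.
  let C : Set ι := {i | ∫⁻ t, ‖g ⟨i, t⟩‖ₑ ∂m i ≠ 0}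
  have hC : C.Countable := Summable.countable_support_ennreal (by
    rw [← lintegral_sigmaMeasure (f := fun ω => ‖g ω‖ₑ) hg.enorm]
    exact hgi.2.ne)
  have : Countable C := hC.to_subtype
  obtain ⟨B, hB, hd, hBc⟩ := exists_disjoint_carriers (ι := C) (m := fun i => m i)
    fun i j hij => hm (Subtype.coe_injective.ne hij)
  obtain ⟨v, hv, hvB⟩ := exists_measurable_piecewise (β := 𝕜)
    (fun o : Option C => o.elim (⋃ i, B i)ᶜ B)
    (fun o => by
      cases o with
      | none => exact (MeasurableSet.iUnion hB).compl
      | some i => exact hB i)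
    (fun o : Option C => o.elim (fun _ => 0) fun i t => c (g ⟨i, t⟩))
    (fun o => by
      cases o with
      | none => exact (measurable_const : Measurable fun _ : X => (0 : 𝕜))
      | some i => exact hcm.comp (hgm i))
    (fun o o' hne t ht => by
      exfalso
      cases o with
      | none =>
        cases o' with
        | none => exact hne rfl
        | some j => exact ht.1 (Set.mem_iUnion_of_mem j ht.2)
      | some i =>
        cases o' with
        | none => exact ht.2 (Set.mem_iUnion_of_mem i ht.1)
        | some j =>
          exact Set.disjoint_left.mp (hd fun h => hne (congrArg some h)) ht.1 ht.2)
  refine ⟨v, hv, fun t => ?_, ?_⟩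
  · by_cases ht : t ∈ ⋃ i, B i
    · obtain ⟨i, hi⟩ := Set.mem_iUnion.mp ht
      rw [hvB (some i) hi]
      exact hc1 _
    · rw [hvB none ht]
      simp
  · refine (ae_sigmaMeasure_iff (measurableSet_eq_fun ((hv.comp measurable_sigmaSnd).mul hg)
      (RCLike.continuous_ofReal.measurable.comp hg.norm))).mpr fun i => ?_
    change ∀ᵐ t ∂m i, v t * g ⟨i, t⟩ = (‖g ⟨i, t⟩‖ : 𝕜)
    by_cases hi : i ∈ C
    · have : ∀ᵐ t ∂m i, t ∈ B ⟨i, hi⟩ := hBc ⟨i, hi⟩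
      filter_upwards [this] with t ht
      rw [hvB (some ⟨i, hi⟩) ht]
      exact hcz _
    · have h0 := (lintegral_eq_zero_iff (hgm i).enorm).mp (not_not.mp hi)
      filter_upwards [h0] with t ht
      have : g ⟨i, t⟩ = 0 := by simpa using ht
      simp [this]

/-- Measurable functions bounded by one are approximated in `L¹` by continuous functions bounded by
one. -/
theorem exists_continuous_norm_le_one_approx [TopologicalSpace X] [NormalSpace X] [BorelSpace X]
    (ρ : Measure X) [IsFiniteMeasure ρ] [ρ.WeaklyRegular] {v : X → 𝕜} (hv : Measurable v)
    (hv1 : ∀ t, ‖v t‖ ≤ 1) {ε : ℝ} (hε : 0 < ε) :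
    ∃ f : C(X, 𝕜), (∀ t, ‖f t‖ ≤ 1) ∧ ∫ t, ‖v t - f t‖ ∂ρ ≤ ε := by
  have hvi : Integrable v ρ := Integrable.of_bound hv.aestronglyMeasurable 1 (ae_of_all _ hv1)
  obtain ⟨f₀, hf₀, hf₀i⟩ := hvi.exists_boundedContinuous_integral_sub_le (half_pos hε)
  have hpos : ∀ t, 0 < max 1 ‖f₀ t‖ := fun t => lt_max_of_lt_left one_pos
  let f : C(X, 𝕜) := ⟨fun t => (((max 1 ‖f₀ t‖)⁻¹ : ℝ) : 𝕜) * f₀ t,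
    (RCLike.continuous_ofReal.comp (Continuous.inv₀ (by fun_prop) fun t => (hpos t).ne')).mul
      f₀.continuous⟩
  have hf1 : ∀ t, ‖f t‖ ≤ 1 := fun t => by
    simp only [f, ContinuousMap.coe_mk, norm_mul, RCLike.norm_ofReal, abs_inv,
      abs_of_pos (hpos t)]
    rw [inv_mul_le_iff₀ (hpos t), mul_one]
    exact le_max_right _ _
  -- Radial retraction moves `f₀ t` by at most its distance to `v t`, a point of the unit ball.
  have hclip : ∀ t, ‖v t - f t‖ ≤ 2 * ‖v t - f₀ t‖ := fun t => by
    have h2 : ‖f₀ t - f t‖ ≤ ‖v t - f₀ t‖ := by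
      have he : f₀ t - f t = ((1 - (max 1 ‖f₀ t‖)⁻¹ : ℝ) : 𝕜) * f₀ t := by
        simp only [f, ContinuousMap.coe_mk]
        push_cast
        ring
      rw [he, norm_mul, RCLike.norm_ofReal]
      rcases le_total ‖f₀ t‖ 1 with h | h
      · rw [max_eq_left h]; simp
      · have h0 : 0 < ‖f₀ t‖ := one_pos.trans_le h
        rw [max_eq_right h, abs_of_nonneg (by rw [sub_nonneg]; exact inv_le_one_of_one_le₀ h),
          sub_mul, inv_mul_cancel₀ h0.ne', one_mul]
        have := norm_sub_norm_le (f₀ t) (v t)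
        rw [norm_sub_rev] at this
        linarith [hv1 t]
    calc ‖v t - f t‖ ≤ ‖v t - f₀ t‖ + ‖f₀ t - f t‖ := norm_sub_le_norm_sub_add_norm_sub _ _ _
      _ ≤ _ := by linarith
  refine ⟨f, hf1, ?_⟩
  calc ∫ t, ‖v t - f t‖ ∂ρ ≤ ∫ t, 2 * ‖v t - f₀ t‖ ∂ρ :=
        integral_mono_of_nonneg (ae_of_all _ fun t => norm_nonneg _)
          ((hvi.sub hf₀i).norm.const_mul 2) (ae_of_all _ hclip)
    _ = 2 * ∫ t, ‖v t - f₀ t‖ ∂ρ := integral_const_mul _ _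
    _ ≤ ε := by linarith

theorem integrable_snd_mul (g : Lp 𝕜 1 (sigmaMeasure m)) {v : X → 𝕜} (hv : Measurable v) {c : ℝ}
    (hc : ∀ t, ‖v t‖ ≤ c) : Integrable (fun ω => v ω.2 * g ω) (sigmaMeasure m) :=
  (L1.integrable_coeFn g).bdd_mul (c := c) (hv.comp measurable_sigmaSnd).aestronglyMeasurable
    (ae_of_all _ fun ω => hc ω.2)

variable [TopologicalSpace X] [CompactSpace X]

theorem norm_integral_snd_mul_le (g : Lp 𝕜 1 (sigmaMeasure m)) (f : C(X, 𝕜)) :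
    ‖∫ ω, f ω.2 * g ω ∂sigmaMeasure m‖ ≤ ‖g‖ * ‖f‖ := by
  rw [L1.norm_eq_integral_norm, mul_comm, ← integral_const_mul]
  refine norm_integral_le_of_norm_le ((L1.integrable_coeFn g).norm.const_mul _)
    (ae_of_all _ fun ω => ?_)
  rw [norm_mul]
  exact mul_le_mul_of_nonneg_right (f.norm_coe_le_norm _) (norm_nonneg _)

/-- The functional `f ↦ ∫ f(π ω) g(ω) dμ(ω)` on `C(X)`, where `π` is the projection of the disjoint
union of copies of `X` onto `X`. -/
def sigmaIntegral [OpensMeasurableSpace X] (m : ι → Measure X) :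
    Lp 𝕜 1 (sigmaMeasure m) →ₗ[𝕜] StrongDual 𝕜 C(X, 𝕜) :=
  have hint : ∀ (g : Lp 𝕜 1 (sigmaMeasure m)) (f : C(X, 𝕜)),
      Integrable (fun ω => f ω.2 * g ω) (sigmaMeasure m) := fun g f =>
    integrable_snd_mul g f.continuous.measurable f.norm_coe_le_norm
  { toFun := fun g => LinearMap.mkContinuous
      { toFun := fun f => ∫ ω, f ω.2 * g ω ∂sigmaMeasure m
        map_add' := fun f₁ f₂ => by
          rw [← integral_add (hint g f₁) (hint g f₂)]
          simp only [ContinuousMap.add_apply, add_mul]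
        map_smul' := fun c f => by
          rw [RingHom.id_apply, smul_eq_mul, ← integral_const_mul]
          simp only [ContinuousMap.smul_apply, smul_eq_mul, mul_assoc] } ‖g‖
      (norm_integral_snd_mul_le g)
    map_add' := fun g₁ g₂ => by
      ext f
      change ∫ ω, f ω.2 * (g₁ + g₂) ω ∂_ = ∫ ω, f ω.2 * g₁ ω ∂_ + ∫ ω, f ω.2 * g₂ ω ∂_
      rw [← integral_add (hint g₁ f) (hint g₂ f)]
      refine integral_congr_ae ?_
      filter_upwards [Lp.coeFn_add g₁ g₂] with ω h
      rw [h, Pi.add_apply, mul_add]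
    map_smul' := fun c g => by
      ext f
      change ∫ ω, f ω.2 * (c • g) ω ∂_ = c * ∫ ω, f ω.2 * g ω ∂_
      rw [← integral_const_mul]
      refine integral_congr_ae ?_
      filter_upwards [Lp.coeFn_smul c g] with ω h
      rw [h, Pi.smul_apply, smul_eq_mul, mul_left_comm] }

theorem sigmaIntegral_apply [OpensMeasurableSpace X] (g : Lp 𝕜 1 (sigmaMeasure m)) (f : C(X, 𝕜)) :
    sigmaIntegral m g f = ∫ ω, f ω.2 * g ω ∂sigmaMeasure m := rfl

/-- The norm of an `L¹` function on the direct sum of singular measures is almost attained, as a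
functional, at a continuous function bounded by one. -/
theorem exists_norm_sub_sigmaIntegral_le [T2Space X] [BorelSpace X]
    [TopologicalSpace.PseudoMetrizableSpace X]
    (hm : Pairwise (onFun Measure.MutuallySingular m)) (g : Lp 𝕜 1 (sigmaMeasure m)) {ε : ℝ}
    (hε : 0 < ε) :
    ∃ f : C(X, 𝕜), (∀ t, ‖f t‖ ≤ 1) ∧ ‖(‖g‖ : 𝕜) - sigmaIntegral m g f‖ ≤ ε := by
  have hg : Measurable g := (Lp.stronglyMeasurable g).measurable
  have hgi : Integrable g (sigmaMeasure m) := L1.integrable_coeFn g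
  obtain ⟨v, hv, hv1, hvg⟩ := exists_measurable_sign hm hg hgi
  -- Approximating `v` in $L^1$ of the image of $|g|\mu$ controls exactly the error in the integral
  -- against `g`.
  let κ : Measure (Σ _ : ι, X) := (sigmaMeasure m).withDensity fun ω => ‖g ω‖ₑ
  have : IsFiniteMeasure κ := isFiniteMeasure_withDensity hgi.2.ne
  obtain ⟨f, hf1, hf⟩ := exists_continuous_norm_le_one_approx (κ.map Sigma.snd) hv hv1 hε
  refine ⟨f, hf1, ?_⟩
  have hdiff : Measurable fun t => ‖v t - f t‖ := (hv.sub f.continuous.measurable).norm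
  rw [integral_map measurable_sigmaSnd.aemeasurable hdiff.aestronglyMeasurable,
    integral_withDensity_eq_integral_toReal_smul hg.enorm
      (ae_of_all _ fun ω => enorm_lt_top)] at hf
  have hgv : (‖g‖ : 𝕜) = ∫ ω, v ω.2 * g ω ∂sigmaMeasure m := by
    rw [integral_congr_ae hvg, integral_ofReal, L1.norm_eq_integral_norm]
  rw [hgv, sigmaIntegral_apply, ← integral_sub (integrable_snd_mul g hv hv1)
    (integrable_snd_mul g f.continuous.measurable hf1)]
  refine (norm_integral_le_integral_norm _).trans (le_of_eq_of_le ?_ hf)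
  refine integral_congr_ae (ae_of_all _ fun ω => ?_)
  change _ = ‖g ω‖ₑ.toReal • ‖v ω.2 - f ω.2‖
  rw [toReal_enorm, smul_eq_mul, mul_comm, ← norm_mul, sub_mul]

end SignFunctions

/-! ### Blending functions on and off $\Delta$ -/

section CutOff

open Filter

/-- Continuous functions vanishing on the Cantor set and increasing to one off it. -/
def cantorCutoff (n : ℕ) : C(unitInterval, ℝ) :=
  ⟨fun t => min 1 (n * Metric.infDist t cantorUnit), by fun_prop⟩

theorem cantorCutoff_nonneg (n : ℕ) (t : unitInterval) : 0 ≤ cantorCutoff n t :=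
  le_min zero_le_one (mul_nonneg n.cast_nonneg Metric.infDist_nonneg)

theorem cantorCutoff_le_one (n : ℕ) (t : unitInterval) : cantorCutoff n t ≤ 1 := min_le_left _ _

theorem cantorCutoff_eq_zero (n : ℕ) {t : unitInterval} (ht : t ∈ cantorUnit) :
    cantorCutoff n t = 0 := by
  simp [cantorCutoff, Metric.infDist_zero_of_mem ht]

theorem eventually_cantorCutoff_eq_one {t : unitInterval} (ht : t ∉ cantorUnit) :
    ∀ᶠ n in atTop, cantorCutoff n t = 1 := by
  have hne : cantorUnit.Nonempty := ⟨0, zero_mem_cantorSet⟩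
  have hpos : 0 < Metric.infDist t cantorUnit :=
    (isClosed_cantorUnit.notMem_iff_infDist_pos hne).mp ht
  obtain ⟨N, hN⟩ := exists_nat_ge (Metric.infDist t cantorUnit)⁻¹
  filter_upwards [eventually_ge_atTop N] with n hn
  refine min_eq_left ?_
  rw [← inv_le_iff_one_le_mul₀ hpos]
  exact hN.trans (by exact_mod_cast hn)

variable {𝕜 : Type*} [RCLike 𝕜]

/-- The convex combination of `F` and `f` that equals `F` on the Cantor set and, in the limit, `f`
off it. -/
def cantorBlend (F f : C(unitInterval, 𝕜)) (n : ℕ) : C(unitInterval, 𝕜) :=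
  ⟨fun t => ((1 - cantorCutoff n t : ℝ) : 𝕜) * F t + (cantorCutoff n t : 𝕜) * f t, by
    refine ((RCLike.continuous_ofReal.comp ?_).mul F.continuous).add
      ((RCLike.continuous_ofReal.comp (cantorCutoff n).continuous).mul f.continuous)
    fun_prop⟩

theorem cantorBlend_apply (F f : C(unitInterval, 𝕜)) (n : ℕ) (t : unitInterval) :
    cantorBlend F f n t = ((1 - cantorCutoff n t : ℝ) : 𝕜) * F t + (cantorCutoff n t : 𝕜) * f t :=
  rfl

theorem norm_cantorBlend_apply_le {F f : C(unitInterval, 𝕜)} (hF : ∀ t, ‖F t‖ ≤ 1)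
    (hf : ∀ t, ‖f t‖ ≤ 1) (n : ℕ) (t : unitInterval) : ‖cantorBlend F f n t‖ ≤ 1 := by
  have h0 := cantorCutoff_nonneg n t
  have h1 := sub_nonneg.mpr (cantorCutoff_le_one n t)
  rw [cantorBlend_apply]
  refine (norm_add_le _ _).trans ?_
  rw [norm_mul, norm_mul, RCLike.norm_ofReal, RCLike.norm_ofReal, abs_of_nonneg h0,
    abs_of_nonneg h1]
  have h2 := mul_le_mul_of_nonneg_left (hF t) h1
  have h3 := mul_le_mul_of_nonneg_left (hf t) h0
  linarith

theorem cantorRestrict_cantorBlend (F f : C(unitInterval, 𝕜)) (n : ℕ) :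
    cantorRestrict 𝕜 (cantorBlend F f n) = cantorRestrict 𝕜 F := by
  ext t
  rw [cantorRestrict_apply, cantorRestrict_apply, cantorBlend_apply,
    cantorCutoff_eq_zero n (show _ ∈ cantorUnit from t.2)]
  simp

theorem eventually_cantorBlend_eq (F f : C(unitInterval, 𝕜)) {t : unitInterval}
    (ht : t ∉ cantorUnit) : ∀ᶠ n in atTop, cantorBlend F f n t = f t := by
  filter_upwards [eventually_cantorCutoff_eq_one ht] with n hn
  rw [cantorBlend_apply, hn]
  simp

/-- Dominated convergence: the measures ignore $\Delta$, and off it the blends are eventually equal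
to `f`. -/
theorem tendsto_sigmaIntegral_cantorBlend {ι : Type*} {m : ι → Measure unitInterval}
    (hm : ∀ i, m i cantorUnit = 0) (g : Lp 𝕜 1 (sigmaMeasure m)) {F f : C(unitInterval, 𝕜)}
    (hF : ∀ t, ‖F t‖ ≤ 1) (hf : ∀ t, ‖f t‖ ≤ 1) :
    Tendsto (fun n => sigmaIntegral m g (cantorBlend F f n)) atTop
      (𝓝 (sigmaIntegral m g f)) := by
  refine tendsto_integral_of_dominated_convergence (fun ω => ‖g ω‖) (fun n => ?_)
    (L1.integrable_coeFn g).norm (fun n => ae_of_all _ fun ω => ?_) ?_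
  · exact (integrable_snd_mul g (cantorBlend F f n).continuous.measurable
      (norm_cantorBlend_apply_le hF hf n)).aestronglyMeasurable
  · rw [norm_mul]
    exact mul_le_of_le_one_left (norm_nonneg _) (norm_cantorBlend_apply_le hF hf n _)
  · have hmeas : MeasurableSet {ω : Σ _ : ι, unitInterval | ω.2 ∉ cantorUnit} :=
      measurable_sigmaSnd isClosed_cantorUnit.measurableSet.compl
    have h : ∀ᵐ ω ∂sigmaMeasure m, ω.2 ∉ cantorUnit :=
      (ae_sigmaMeasure_iff hmeas).mpr fun i => measure_eq_zero_iff_ae_notMem.mp (hm i)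
    filter_upwards [h] with ω hω
    refine tendsto_const_nhds.congr' ?_
    filter_upwards [eventually_cantorBlend_eq F f hω] with n hn
    rw [hn]

end CutOff

/-! ### The dual of $X(E)$ -/

section Dual

open Filter
open Function (onFun)

variable {𝕜 : Type*} [RCLike 𝕜] {E : Type*} [NormedAddCommGroup E] [NormedSpace 𝕜 E]
  (J : E →ₗᵢ[𝕜] C(cantorSet, 𝕜))

/-- The restriction operator from `X(E)` onto `E`. -/
def cantorQuotient : cantorExtensionSpace J →ₗ[𝕜] E :=
  (LinearEquiv.ofInjective J.toLinearMap J.injective).symm.toLinearMap ∘ₗ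
    (cantorRestrict 𝕜).restrict (p := cantorExtensionSpace J)
      (q := LinearMap.range J.toLinearMap) fun _ hf => hf

theorem map_cantorQuotient (f : cantorExtensionSpace J) :
    J (cantorQuotient J f) = cantorRestrict 𝕜 f :=
  (LinearEquiv.ofInjective_apply (h := J.injective) J.toLinearMap _).symm.trans
    (congrArg Subtype.val ((LinearEquiv.ofInjective J.toLinearMap J.injective).apply_symm_apply _))

theorem norm_cantorQuotient_le (f : cantorExtensionSpace J) : ‖cantorQuotient J f‖ ≤ ‖f‖ := by
  rw [← J.norm_map, map_cantorQuotient J f]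
  exact norm_cantorRestrict_le _

theorem norm_cantorQuotient_add_sigmaIntegral_le {ι : Type*} {m : ι → Measure unitInterval}
    (p : WithLp 1 (BanachDual 𝕜 E × Lp 𝕜 1 (sigmaMeasure m))) (f : cantorExtensionSpace J) :
    ‖p.fst (cantorQuotient J f) + sigmaIntegral m p.snd f‖ ≤ (‖p.fst‖ + ‖p.snd‖) * ‖f‖ := by
  rw [add_mul]
  refine norm_add_le_of_le ?_ (norm_integral_snd_mul_le p.snd f)
  exact p.fst.le_opNorm_of_le (norm_cantorQuotient_le J f)

/-- The functional on `X(E)` given by a functional on `E` and an integrable function off the Cantor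
set. -/
def cantorDualMap {ι : Type*} (m : ι → Measure unitInterval) :
    WithLp 1 (BanachDual 𝕜 E × Lp 𝕜 1 (sigmaMeasure m)) →ₗ[𝕜]
      BanachDual 𝕜 (cantorExtensionSpace J) where
  toFun p := LinearMap.mkContinuous (p.fst.toLinearMap ∘ₗ cantorQuotient J +
    (sigmaIntegral m p.snd).toLinearMap ∘ₗ (cantorExtensionSpace J).subtype)
    (‖p.fst‖ + ‖p.snd‖) (norm_cantorQuotient_add_sigmaIntegral_le J p)
  map_add' p q := by
    ext f
    change (p + q).fst _ + sigmaIntegral m (p + q).snd _ = p.fst _ + sigmaIntegral m p.snd _ +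
      (q.fst _ + sigmaIntegral m q.snd _)
    rw [WithLp.add_fst, WithLp.add_snd, map_add, add_apply, add_apply, add_add_add_comm]
  map_smul' c p := by
    ext f
    change (c • p.fst) _ + sigmaIntegral m (c • p.snd) _ = c • (p.fst _ + sigmaIntegral m p.snd _)
    rw [map_smul, smul_apply, smul_apply, smul_add]

theorem cantorDualMap_apply {ι : Type*} (m : ι → Measure unitInterval)
    (p : WithLp 1 (BanachDual 𝕜 E × Lp 𝕜 1 (sigmaMeasure m))) (f : cantorExtensionSpace J) :
    cantorDualMap J m p f = p.fst (cantorQuotient J f) + sigmaIntegral m p.snd f := rfl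

/-- For `≥`, take `F` extending an almost norming element for `p.fst` and `f` almost norming for
`p.snd`. Blending fixes the first term and sends the second to its value at `f`; a unimodular factor
`c` makes the first term nonnegative, so nothing cancels. -/
theorem norm_cantorDualMap {ι : Type*} {m : ι → Measure unitInterval}
    (hsing : Pairwise (onFun Measure.MutuallySingular m)) (hm : ∀ i, m i cantorUnit = 0)
    (p : WithLp 1 (BanachDual 𝕜 E × Lp 𝕜 1 (sigmaMeasure m))) :
    ‖cantorDualMap J m p‖ = ‖p‖ := by
  rw [WithLp.prod_norm_eq_of_L1]
  apply le_antisymm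
  · exact LinearMap.mkContinuous_norm_le _ (by positivity)
      (norm_cantorQuotient_add_sigmaIntegral_le J p)
  · refine le_of_forall_pos_le_add fun ε hε => ?_
    obtain ⟨x₀, hx₀, hlt⟩ := p.fst.exists_lt_apply_of_lt_opNorm
      (sub_lt_self ‖p.fst‖ (half_pos hε))
    obtain ⟨c, hc, hcx⟩ := RCLike.exists_norm_eq_mul_self (p.fst x₀)
    have hx : ‖c • x₀‖ ≤ 1 := by rw [norm_smul, hc, one_mul]; exact hx₀.le
    have hpx : p.fst (c • x₀) = (‖p.fst x₀‖ : 𝕜) := by rw [map_smul, smul_eq_mul, hcx]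
    obtain ⟨F, hFJ, hFn⟩ := exists_cantorRestrict_eq (J (c • x₀))
    rw [J.norm_map] at hFn
    have hF1 : ∀ t, ‖F t‖ ≤ 1 := fun t => (F.norm_coe_le_norm t).trans (hFn.trans hx)
    obtain ⟨f, hf1, hf⟩ := exists_norm_sub_sigmaIntegral_le hsing p.snd (half_pos hε)
    have hmem : ∀ n, cantorBlend F f n ∈ cantorExtensionSpace J := fun n =>
      ⟨c • x₀, by rw [cantorRestrict_cantorBlend, hFJ]; rfl⟩
    have hq : ∀ n, cantorQuotient J ⟨_, hmem n⟩ = c • x₀ := fun n => J.injective (by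
      rw [map_cantorQuotient, cantorRestrict_cantorBlend, hFJ])
    have hbound : ∀ n, ‖(‖p.fst x₀‖ : 𝕜) + sigmaIntegral m p.snd (cantorBlend F f n)‖ ≤
        ‖cantorDualMap J m p‖ := fun n => by
      have h := (cantorDualMap J m p).le_opNorm_of_le (x := ⟨_, hmem n⟩) (c := 1)
        ((ContinuousMap.norm_le _ zero_le_one).mpr (norm_cantorBlend_apply_le hF1 hf1 n))
      rwa [cantorDualMap_apply, hq, hpx, mul_one] at h
    have hlim := le_of_tendsto
      ((tendsto_sigmaIntegral_cantorBlend hm p.snd hF1 hf1).const_add _).norm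
      (Eventually.of_forall hbound)
    have hsum : ‖p.fst x₀‖ + ‖p.snd‖ ≤
        ‖(‖p.fst x₀‖ : 𝕜) + sigmaIntegral m p.snd f‖ + ε / 2 := by
      have he : (‖p.fst x₀‖ + ‖p.snd‖ : 𝕜) = (‖p.fst x₀‖ + sigmaIntegral m p.snd f) +
          (‖p.snd‖ - sigmaIntegral m p.snd f) := by ring
      have hn : ‖(‖p.fst x₀‖ + ‖p.snd‖ : 𝕜)‖ = ‖p.fst x₀‖ + ‖p.snd‖ := by
        rw [← RCLike.ofReal_add, RCLike.norm_ofReal, abs_of_nonneg (by positivity)]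
      rw [← hn, he]
      exact norm_add_le_of_le le_rfl hf
    linarith

theorem surjective_cantorDualMap {ι : Type*} {m : ι → Measure unitInterval}
    [∀ i, IsFiniteMeasure (m i)] (hsing : Pairwise (onFun Measure.MutuallySingular m))
    (hmax : ∀ ν : Measure unitInterval, IsFiniteMeasure ν → ν cantorUnit = 0 →
      (∀ i, ν.MutuallySingular (m i)) → ν = 0) :
    Function.Surjective (cantorDualMap J m) := fun φ => by
  obtain ⟨ψ, hψ, -⟩ := exists_extension_norm_eq (cantorExtensionSpace J) φ
  obtain ⟨ν, h, _, hmeas, hint, hrep⟩ := exists_integral_representation ψ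
  have hD : MeasurableSet cantorUnit := isClosed_cantorUnit.measurableSet
  have hfh : ∀ f : C(unitInterval, 𝕜), Integrable (fun t => f t * h t) ν := fun f =>
    hint.bdd_mul f.continuous.aestronglyMeasurable (ae_of_all _ f.norm_coe_le_norm)
  obtain ⟨k, hk, hkfin, hkν⟩ := exists_map_snd_withDensity_eq hsing hmax
    (ν.restrict cantorUnitᶜ) (by rw [Measure.restrict_apply hD]; simp)
  have hgi : Integrable (fun ω => (k ω).toReal • h ω.2) (sigmaMeasure m) := by
    rw [← integrable_withDensity_iff_integrable_smul' hk hkfin]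
    have := hint.restrict (s := cantorUnitᶜ)
    rw [← hkν] at this
    exact this.comp_measurable measurable_sigmaSnd
  have hg : ∀ f : C(unitInterval, 𝕜),
      sigmaIntegral m hgi.toL1 f = ∫ t in cantorUnitᶜ, f t * h t ∂ν := fun f => by
    have hfm : StronglyMeasurable fun t => f t * h t := f.continuous.stronglyMeasurable.mul hmeas
    rw [← hkν, integral_map measurable_sigmaSnd.aemeasurable hfm.aestronglyMeasurable,
      integral_withDensity_eq_integral_toReal_smul hk hkfin, sigmaIntegral_apply]
    refine integral_congr_ae ?_
    filter_upwards [hgi.coeFn_toL1] with ω hω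
    rw [hω, mul_smul_comm]
  let incl : cantorSet → unitInterval := Set.inclusion cantorSet_subset_unitInterval
  have hincl : MeasurableEmbedding incl :=
    ((continuous_inclusion _).isClosedEmbedding
      (Set.inclusion_injective cantorSet_subset_unitInterval)).measurableEmbedding
  have hrange : Set.range incl = cantorUnit := by
    ext t
    exact ⟨fun ⟨s, hs⟩ => hs ▸ s.2, fun ht => ⟨⟨t, ht⟩, rfl⟩⟩
  have hmap : (ν.comap incl).map incl = ν.restrict cantorUnit := by
    rw [hincl.map_comap, hrange]
  have hhi : Integrable (fun s => h (incl s)) (ν.comap incl) := by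
    have := hint.restrict (s := cantorUnit)
    rw [← hmap] at this
    exact this.comp_measurable hincl.measurable
  have hei : ∀ g : C(cantorSet, 𝕜), Integrable (fun s => g s * h (incl s)) (ν.comap incl) :=
    fun g => hhi.bdd_mul g.continuous.aestronglyMeasurable (ae_of_all _ g.norm_coe_le_norm)
  -- The part of the representing measure on $\Delta$, pulled back along `J`.
  let e : BanachDual 𝕜 E := LinearMap.mkContinuous
    { toFun := fun x => ∫ s, J x s * h (incl s) ∂(ν.comap incl)
      map_add' := fun x y => by
        rw [← integral_add (hei _) (hei _)]
        simp only [map_add, ContinuousMap.add_apply, add_mul]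
      map_smul' := fun c x => by
        rw [RingHom.id_apply, smul_eq_mul, ← integral_const_mul]
        simp only [map_smul, ContinuousMap.smul_apply, smul_eq_mul, mul_assoc] }
    (∫ s, ‖h (incl s)‖ ∂(ν.comap incl)) fun x => by
      rw [mul_comm, ← integral_const_mul]
      refine norm_integral_le_of_norm_le (hhi.norm.const_mul _) (ae_of_all _ fun s => ?_)
      rw [norm_mul]
      exact mul_le_mul_of_nonneg_right (((J x).norm_coe_le_norm s).trans_eq (J.norm_map x))
        (norm_nonneg _)
  have he : ∀ f : cantorExtensionSpace J,
      e (cantorQuotient J f) = ∫ t in cantorUnit, (f : C(unitInterval, 𝕜)) t * h t ∂ν := fun f => by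
    change ∫ s, J (cantorQuotient J f) s * h (incl s) ∂(ν.comap incl) = _
    rw [map_cantorQuotient, ← hmap, hincl.integral_map]
    rfl
  refine ⟨WithLp.toLp 1 (e, hgi.toL1), ?_⟩
  ext f
  rw [cantorDualMap_apply, ← hψ f, hrep]
  change e (cantorQuotient J f) + sigmaIntegral m hgi.toL1 f = _
  rw [he, hg, integral_add_compl hD (hfh f)]

/-- The first factor of an `ℓ₁`-sum is an `L`-summand. -/
theorem exists_isLSummand_of_equiv {A B V : Type*} [NormedAddCommGroup A] [NormedSpace 𝕜 A]
    [NormedAddCommGroup B] [NormedSpace 𝕜 B] [NormedAddCommGroup V] [NormedSpace 𝕜 V]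
    (Ψ : V ≃ₗᵢ[𝕜] WithLp 1 (A × B)) :
    ∃ Z : Submodule 𝕜 V, IsLSummand Z ∧ Nonempty (A ≃ₗᵢ[𝕜] Z) := by
  let j : A →ₗᵢ[𝕜] V :=
    { toFun := fun a => Ψ.symm (WithLp.toLp 1 (a, 0))
      map_add' := fun a b => by
        rw [← map_add, ← WithLp.toLp_add, Prod.mk_add_mk, add_zero]
      map_smul' := fun c a => by
        rw [RingHom.id_apply, ← map_smul, ← WithLp.toLp_smul, Prod.smul_mk, smul_zero]
      norm_map' := fun a => by
        change ‖Ψ.symm (WithLp.toLp 1 (a, 0))‖ = ‖a‖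
        rw [LinearIsometryEquiv.norm_map, WithLp.prod_norm_eq_of_L1]
        simp }
  -- Describing the summand as a kernel gives closedness without completeness of `A`.
  have hZ : ∀ v, v ∈ LinearMap.range j.toLinearMap ↔ (Ψ v).snd = 0 := fun v => by
    constructor
    · rintro ⟨a, rfl⟩
      change (Ψ (Ψ.symm (WithLp.toLp 1 (a, 0)))).snd = 0
      rw [Ψ.apply_symm_apply]
      rfl
    · intro hv
      refine ⟨(Ψ v).fst, ?_⟩
      change Ψ.symm (WithLp.toLp 1 ((Ψ v).fst, 0)) = v
      rw [← hv]
      exact Ψ.symm_apply_apply v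
  let W : Submodule 𝕜 V :=
    { carrier := {v | (Ψ v).fst = 0}
      add_mem' := fun {a b} ha hb => by
        change (Ψ (a + b)).fst = 0
        rw [map_add, WithLp.add_fst, show (Ψ a).fst = 0 from ha, show (Ψ b).fst = 0 from hb,
          add_zero]
      zero_mem' := by
        change (Ψ 0).fst = 0
        rw [map_zero, WithLp.zero_fst]
      smul_mem' := fun c a ha => by
        change (Ψ (c • a)).fst = 0
        rw [map_smul, WithLp.smul_fst, show (Ψ a).fst = 0 from ha, smul_zero] }
  have hW : ∀ v, v ∈ W ↔ (Ψ v).fst = 0 := fun v => Iff.rfl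
  have hc : Continuous fun v => (Ψ v).ofLp := (WithLp.prod_continuous_ofLp 1 A B).comp Ψ.continuous
  refine ⟨LinearMap.range j.toLinearMap, ⟨?_, W, ?_, ⟨?_, ?_⟩, fun z hz w hw => ?_⟩, ⟨j.equivRange⟩⟩
  · have : (LinearMap.range j.toLinearMap : Set V) = {v | (Ψ v).snd = 0} := Set.ext hZ
    rw [this]
    exact isClosed_eq (continuous_snd.comp hc) continuous_const
  · exact isClosed_eq (continuous_fst.comp hc) continuous_const
  · rw [Submodule.disjoint_def]
    intro v hv hv'
    have : Ψ v = 0 := WithLp.ofLp_injective 1 (Prod.ext ((hW v).mp hv') ((hZ v).mp hv))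
    exact (map_eq_zero_iff Ψ Ψ.injective).mp this
  · rw [codisjoint_iff, eq_top_iff]
    intro v _
    refine Submodule.mem_sup.mpr ⟨Ψ.symm (WithLp.toLp 1 ((Ψ v).fst, 0)), ⟨(Ψ v).fst, rfl⟩,
      Ψ.symm (WithLp.toLp 1 (0, (Ψ v).snd)), ?_, ?_⟩
    · rw [hW, Ψ.apply_symm_apply]
      rfl
    · rw [← map_add, ← WithLp.toLp_add, Prod.mk_add_mk, add_zero, zero_add]
      exact Ψ.symm_apply_apply v
  · rw [← Ψ.norm_map, ← Ψ.norm_map z, ← Ψ.norm_map w, map_add, WithLp.prod_norm_eq_of_L1,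
      WithLp.prod_norm_eq_of_L1, WithLp.prod_norm_eq_of_L1, WithLp.add_fst, WithLp.add_snd,
      (hZ z).mp hz, (hW w).mp hw]
    simp

/-- The fibres are indexed by a set of measures on $[0,1]$, so `Ω` lies in `Type` whatever the
universes of `𝕜` and `E`. -/
theorem exists_localizable_dual_equiv :
    ∃ (Ω : Type) (_ : MeasurableSpace Ω) (μ : Measure Ω), IsLocalizable μ ∧
      Nonempty (BanachDual 𝕜 (cantorExtensionSpace J) ≃ₗᵢ[𝕜]
        WithLp 1 (BanachDual 𝕜 E × Lp 𝕜 1 μ)) := by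
  obtain ⟨S, hS, hsing, hmax⟩ := exists_maximal_singular_family cantorUnit
  let m : S → Measure unitInterval := Subtype.val
  have : ∀ i, IsFiniteMeasure (m i) := fun i => (hS i i.2).1
  have hsing' : Pairwise (onFun Measure.MutuallySingular m) := fun i j hij =>
    hsing i.2 j.2 (Subtype.coe_injective.ne hij)
  have hsurj := surjective_cantorDualMap J hsing'
    fun ν hν hD h => hmax ν hν hD fun μ hμ => h ⟨μ, hμ⟩
  let Φ : WithLp 1 (BanachDual 𝕜 E × Lp 𝕜 1 (sigmaMeasure m)) →ₗᵢ[𝕜]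
      BanachDual 𝕜 (cantorExtensionSpace J) :=
    ⟨cantorDualMap J m, norm_cantorDualMap J hsing' fun i => (hS i i.2).2⟩
  exact ⟨_, inferInstance, sigmaMeasure m, isLocalizable_sigmaMeasure,
    ⟨(LinearIsometryEquiv.ofSurjective Φ hsurj).symm⟩⟩

end Dual

end

theorem mainTheorem1 {𝕜 : Type*} [RCLike 𝕜] (E : Type*) [NormedAddCommGroup E] [NormedSpace 𝕜 E]
    [CompleteSpace E] [TopologicalSpace.SeparableSpace E] :
    Nonempty (E →ₗᵢ[𝕜] C(cantorSet, 𝕜)) ∧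
    ∀ J : E →ₗᵢ[𝕜] C(cantorSet, 𝕜),
      IsCRich (cantorExtensionSpace J) ∧
      (∃ Z : Submodule 𝕜 (BanachDual 𝕜 (cantorExtensionSpace J)),
        IsLSummand Z ∧ Nonempty (BanachDual 𝕜 E ≃ₗᵢ[𝕜] Z)) ∧
      (∃ (Ω : Type) (_ : MeasurableSpace Ω) (μ : Measure Ω), IsLocalizable μ ∧
        Nonempty (BanachDual 𝕜 (cantorExtensionSpace J) ≃ₗᵢ[𝕜]
          WithLp 1 (BanachDual 𝕜 E × Lp 𝕜 1 μ))) := by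
  refine ⟨exists_linearIsometry_cantorSet 𝕜 E, fun J => ?_⟩
  obtain ⟨Ω, mΩ, μ, hμ, ⟨Ψ⟩⟩ := exists_localizable_dual_equiv J
  exact ⟨isCRich_cantorExtensionSpace J, exists_isLSummand_of_equiv Ψ, Ω, mΩ, μ, hμ, ⟨Ψ⟩⟩
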